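/- All graphs are finite and simple. A graph is 2-connected if it has at least three vertices, is connected, and remains connected after the deletion of any single vertex; it is subcubic if all its vertices have degree at most 3. The degree of $v$ in $G$ is written $d_G(v)$, and $|E(P)|$ denotes the length of a path $P$. (a) Let $G$ be a 2-connected subcubic graph and let $x,y,z\in V(G)$ with $x\neq y$. If $d_G(v)=3$ for all $v\in V(G)\setminus\{x,y,z\}$, then there are two $x$–$y$ paths $P_1,P_2$ in $G$ with $1\leq |E(P_1)|-|E(P_2)|\leq 2$. (b) Let $G$ be a 2-connected graph which is not a 3-cycle, let $xy\in E(G)$ and $z\in V(G)\setminus\{x,y\}$. If $d_G(x)\leq 4$, $d_G(y)\leq 4$, $d_G(z)\leq 3$ and $d_G(v)=3$ for all $v\in V(G)\setminus\{x,y,z\}$, then there are two $x$–$y$ paths $P_1,P_2$ in $G-xy$ (the graph obtained from $G$ by deleting the edge $xy$) with $1\leq |E(P_1)|-|E(P_2)|\leq 2$. -/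

import Mathlib

namespace SimpleGraph

/-- A graph is 2-connected if it has at least three vertices, is connected, and stays connected
after the deletion of any one vertex. -/
def IsTwoConnected {V : Type*} (G : SimpleGraph V) : Prop :=
  3 ≤ ENat.card V ∧ G.Connected ∧ ∀ v : V, (G.induce {v}ᶜ).Connected

/-- A (finite) graph is subcubic if all its degrees are at most 3. -/
def IsSubcubic {V : Type*} [Fintype V] (G : SimpleGraph V) [DecidableRel G.Adj] : Prop :=
  ∀ v : V, G.degree v ≤ 3

/-- There are two `x`–`y` paths `P₁`, `P₂` in `G` with `1 ≤ |E(P₁)| - |E(P₂)| ≤ 2`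
(the difference is taken in the integers). -/
def HasTwoPathsDifferingByOneOrTwo {V : Type*} (G : SimpleGraph V) (x y : V) : Prop :=
  ∃ P₁ P₂ : G.Walk x y, P₁.IsPath ∧ P₂.IsPath ∧
    1 ≤ (P₁.length : ℤ) - (P₂.length : ℤ) ∧ (P₁.length : ℤ) - (P₂.length : ℤ) ≤ 2

end SimpleGraph

/-! Only lower bounds on degrees matter, so the claim is generalised to rooted subgraphs
(`IsRooted`) and proved by induction on the vertex set S. Both defining conditions concern vertices
other than the roots x and y, so the edge xy may be deleted first.

A triangle at x gives two paths whose lengths differ by 1. A 4-cycle through x avoiding y gives a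
difference of 2, or else a 2-separation to which induction applies. Otherwise let D be the component
of y after deleting x and N(x). Each vertex of D other than y has at most one neighbour in N(x), so
contracting N(x) to a single root preserves the degree condition; induction applies, and the paths
lift to G and are extended to x. When D is too small for this, either two short paths exist, or z is
the only neighbour of y and can replace y as a root, or N(y) ⊆ N(x).

By symmetry there remains N(x) = N(y). Then fix a ≠ z in N(x), contract N(x) \ {a}, and apply the
same contraction lemma to the component of a; paths from a to c in N(x) \ {a} extend by the edges xa
and cy. -/

namespace SimpleGraph

variable {V : Type*} {G : SimpleGraph V}

/-- `G.PathTo v T u n`: there is a path of length `n` from `u` to `v` in `G` all of whose vertices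
lie in `T`. -/
inductive PathTo (G : SimpleGraph V) (v : V) : Set V → V → ℕ → Prop
  | nil {T : Set V} (h : v ∈ T) : PathTo G v T v 0
  | cons {T : Set V} {u w : V} {n : ℕ} (hu : u ∈ T) (h : G.Adj u w)
      (p : PathTo G v (T \ {u}) w n) : PathTo G v T u (n + 1)

/-! ### Paths of given length inside a vertex set -/

namespace PathTo

variable {T T' : Set V} {u v w : V} {m n : ℕ}

theorem start_mem (p : G.PathTo v T u n) : u ∈ T := by
  cases p <;> assumption

theorem end_mem (p : G.PathTo v T u n) : v ∈ T := by
  induction p with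
  | nil h => exact h
  | cons hu h p ih => exact ih.1

theorem map {G' : SimpleGraph V} (p : G.PathTo v T u n)
    (hG : ∀ a ∈ T, ∀ b ∈ T, G.Adj a b → G'.Adj a b) (hT : T ⊆ T') : G'.PathTo v T' u n := by
  induction p generalizing T' with
  | nil h => exact .nil (hT h)
  | cons hu h p ih =>
    exact .cons (hT hu) (hG _ hu _ p.start_mem.1 h)
      (ih (fun a ha b hb => hG a ha.1 b hb.1) (Set.sdiff_subset_sdiff_left hT))

theorem mono (p : G.PathTo v T u n) (hT : T ⊆ T') : G.PathTo v T' u n :=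
  p.map (fun _ _ _ _ h => h) hT

theorem append (p : G.PathTo v T u n) (q : G.PathTo w T' v m)
    (hT : ∀ a ∈ T, a ∈ T' → a = v) : G.PathTo w (T ∪ T') u (n + m) := by
  induction p with
  | nil h => simpa using q.mono Set.subset_union_right
  | @cons T u w' n hu h p ih =>
    have key := ih (fun a ha => hT a ha.1)
    rw [Nat.add_right_comm]
    refine .cons (Or.inl hu) h (key.mono ?_)
    rintro a (ha | ha)
    · exact ⟨Or.inl ha.1, ha.2⟩
    · refine ⟨Or.inr ha, ?_⟩
      rintro rfl
      exact p.end_mem.2 (hT a hu ha).symm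

theorem single (h : G.Adj u v) : G.PathTo v {u, v} u 1 :=
  .cons (by simp) h (.nil ⟨by simp, h.ne'⟩)

theorem reverse (p : G.PathTo v T u n) : G.PathTo u T v n := by
  induction p with
  | nil h => exact .nil h
  | @cons T u w n hu h p ih =>
    refine (ih.append (single h.symm) ?_).mono ?_
    · rintro a ha (rfl | rfl)
      · rfl
      · exact absurd rfl ha.2
    · rintro a (ha | rfl | rfl)
      · exact ha.1
      · exact p.start_mem.1
      · exact hu

/-- If the path meets `u`, its tail from `u` no longer contains the starting vertex `w`. -/
theorem avoid_or_through (p : G.PathTo v T w n) (hu : w ≠ u) :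
    G.PathTo v (T \ {u}) w n ∨ ∃ m, G.PathTo v (T \ {w}) u m := by
  induction p with
  | nil h => exact Or.inl (.nil ⟨h, hu⟩)
  | @cons T w w' n hw h p ih =>
    by_cases hw' : w' = u
    · subst hw'
      exact Or.inr ⟨_, p⟩
    · rcases ih hw' with q | ⟨m, q⟩
      · exact Or.inl (.cons ⟨hw, hu⟩ h (q.mono fun a ha => ⟨⟨ha.1.1, ha.2⟩, ha.1.2⟩))
      · exact Or.inr ⟨m, q.mono Set.sdiff_subset⟩

theorem exists_cons (p : G.PathTo v T w n) (hu : u ∈ T) (h : G.Adj u w) :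
    ∃ m, G.PathTo v T u m := by
  rcases p.avoid_or_through h.ne' with q | ⟨m, q⟩
  · exact ⟨_, .cons hu h q⟩
  · exact ⟨m, q.mono Set.sdiff_subset⟩

theorem exists_boundary (p : G.PathTo v T u n) {A : Set V} (hu : u ∈ A) (hv : v ∉ A) :
    ∃ a ∈ A, ∃ b ∈ T, b ∉ A ∧ G.Adj a b := by
  induction p with
  | nil h => exact absurd hu hv
  | @cons T u w n hu' h p ih =>
    by_cases hw : w ∈ A
    · obtain ⟨a, ha, b, hb, h'⟩ := ih hw
      exact ⟨a, ha, b, hb.1, h'⟩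
    · exact ⟨u, hu, w, p.start_mem.1, hw, h⟩

theorem in_component (p : G.PathTo v T u n) : G.PathTo v {a | ∃ m, G.PathTo v T a m} u n := by
  induction p with
  | nil h => exact .nil ⟨0, .nil h⟩
  | @cons T u w n hu h p ih =>
    refine .cons ⟨_, .cons hu h p⟩ h (ih.mono ?_)
    rintro a ⟨m, q⟩
    exact ⟨⟨m, q.mono Set.sdiff_subset⟩, q.start_mem.2⟩

theorem exists_walk (p : G.PathTo v T u n) :
    ∃ q : G.Walk u v, q.IsPath ∧ q.length = n ∧ ∀ a ∈ q.support, a ∈ T := by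
  induction p with
  | nil h => exact ⟨.nil, by simp, rfl, by simpa using h⟩
  | @cons T u w n hu h p ih =>
    obtain ⟨q, hq, hl, hs⟩ := ih
    refine ⟨.cons h q, ?_, by simp [hl], ?_⟩
    · rw [Walk.cons_isPath_iff]
      exact ⟨hq, fun hu' => (hs u hu').2 rfl⟩
    · intro a ha
      rw [Walk.support_cons, List.mem_cons] at ha
      rcases ha with rfl | ha
      · exact hu
      · exact (hs a ha).1

end PathTo

/-- Two `x`–`y` paths of `G` inside `T` whose lengths differ by one or two. -/
def TwoPathsIn (G : SimpleGraph V) (T : Set V) (x y : V) : Prop :=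
  ∃ m n, G.PathTo y T x m ∧ G.PathTo y T x n ∧ n < m ∧ m ≤ n + 2

theorem TwoPathsIn.symm {T : Set V} {x y : V} (h : G.TwoPathsIn T x y) : G.TwoPathsIn T y x := by
  obtain ⟨m, n, p, q, h⟩ := h
  exact ⟨m, n, p.reverse, q.reverse, h⟩

theorem TwoPathsIn.hasTwoPaths {T : Set V} {x y : V} (h : G.TwoPathsIn T x y) :
    G.HasTwoPathsDifferingByOneOrTwo x y := by
  obtain ⟨m, n, p, q, h⟩ := h
  obtain ⟨p', hp, hpl, -⟩ := p.exists_walk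
  obtain ⟨q', hq, hql, -⟩ := q.exists_walk
  exact ⟨p', q', hp, hq, by omega, by omega⟩

/-- The subgraph of `G` on `S`, with the edge `xy` added, is 2-connected (every nonempty vertex set
avoiding `x` and `y` has two neighbours outside of it), and every vertex of it other than
`x`, `y`, `z` has at least three neighbours. -/
structure IsRooted (G : SimpleGraph V) (S : Set V) (x y z : V) : Prop where
  left_mem : x ∈ S
  right_mem : y ∈ S
  ne : x ≠ y
  deg : ∀ v ∈ S, v ≠ x → v ≠ y → v ≠ z → ∀ p q, ∃ u ∈ S, G.Adj v u ∧ u ≠ p ∧ u ≠ q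
  link : ∀ A ⊆ S, A.Nonempty → x ∉ A → y ∉ A → ∀ w, ∃ a ∈ A, ∃ b ∈ S, b ∉ A ∧ b ≠ w ∧ G.Adj a b

/-- Every rooted subgraph on a proper subset of `S` with at least four vertices has two paths
between its roots whose lengths differ by one or two. -/
def TwoPathsBelow (S : Set V) : Prop :=
  ∀ S' ⊂ S, ∀ (G : SimpleGraph V) (x y z : V), G.IsRooted S' x y z → (S' \ {x, y}).Nontrivial →
    G.TwoPathsIn S' x y

/-! ### Separations, triangles and 4-cycles at a root -/

namespace IsRooted

variable {S : Set V} {x y z : V}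

theorem symm (h : G.IsRooted S x y z) : G.IsRooted S y x z :=
  ⟨h.right_mem, h.left_mem, h.ne.symm, fun v hv h1 h2 => h.deg v hv h2 h1,
    fun A hA hn h1 h2 => h.link A hA hn h2 h1⟩

theorem exists_pathTo_right (h : G.IsRooted S x y z) {u : V} (hu : u ∈ S) (hux : u ≠ x) :
    ∃ n, G.PathTo y (S \ {x}) u n := by
  by_contra hcon
  obtain ⟨a, ⟨⟨haS, hax⟩, ha⟩, b, hb, hbA, hbx, hab⟩ :=
    h.link {a | a ∈ S \ {x} ∧ ¬ ∃ n, G.PathTo y (S \ {x}) a n} (fun a ha => ha.1.1)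
      ⟨u, ⟨hu, hux⟩, hcon⟩ (fun hx => hx.1.2 rfl)
      (fun hy => hy.2 ⟨0, .nil hy.1⟩) x
  refine hbA ⟨⟨hb, hbx⟩, ?_⟩
  rintro ⟨n, p⟩
  exact ha (p.exists_cons ⟨haS, hax⟩ hab)

theorem of_separation (h : G.IsRooted S x y z) {C : Set V} {p q : V} (hC : C ⊆ S) (hx : x ∉ C)
    (hy : y ∉ C) (hpq : p ≠ q)
    (hcl : ∀ a ∈ C, ∀ b ∈ S, G.Adj a b → b ∈ C ∨ b = p ∨ b = q) :
    G.IsRooted (C ∪ {p, q}) p q z := by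
  refine ⟨by simp, by simp, hpq, ?_, ?_⟩
  · rintro v (hv | rfl | rfl) h1 h2 h3 s t
    · obtain ⟨u, hu, hvu, h'⟩ := h.deg v (hC hv) (fun e => hx (e ▸ hv)) (fun e => hy (e ▸ hv)) h3 s t
      exact ⟨u, hcl v hv u hu hvu, hvu, h'⟩
    · exact absurd rfl h1
    · exact absurd rfl h2
  · intro A hA hne hp hq w
    have hAC : A ⊆ C := by
      intro a ha
      rcases hA ha with h' | rfl | rfl
      · exact h'
      · exact absurd ha hp
      · exact absurd ha hq
    obtain ⟨a, ha, b, hb, h1, h2, h3⟩ := h.link A (hAC.trans hC) hne (fun e => hx (hAC e))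
      (fun e => hy (hAC e)) w
    exact ⟨a, ha, b, hcl a (hAC ha) b hb h3, h1, h2, h3⟩

theorem twoPathsIn_of_triangle (h : G.IsRooted S x y z) {a b : V} (ha : a ∈ S)
    (hb : b ∈ S) (hxa : G.Adj x a) (hxb : G.Adj x b) (hab : G.Adj a b) : G.TwoPathsIn S x y := by
  have key : ∀ {a b : V} {n : ℕ}, a ∈ S → b ∈ S → G.Adj x a → G.Adj x b → G.Adj a b →
      G.PathTo y ((S \ {x}) \ {b}) a n → G.TwoPathsIn S x y := by
    intro a b n ha hb hxa hxb hab p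
    exact ⟨n + 2, n + 1, .cons h.left_mem hxb (.cons ⟨hb, hxb.ne'⟩ hab.symm p),
      .cons h.left_mem hxa (p.mono Set.sdiff_subset), by omega, by omega⟩
  obtain ⟨n, p⟩ := h.exists_pathTo_right ha hxa.ne'
  rcases p.avoid_or_through hab.ne with q | ⟨m, q⟩
  · exact key ha hb hxa hxb hab q
  · exact key hb ha hxb hxa hab.symm q

/-- A path to `y` from `a` or `b` that misses the rest of the cycle can be entered directly from `x`
or the long way round through `v`: lengths `n + 1` and `n + 3`. -/
theorem twoPathsIn_of_fourCycle (h : G.IsRooted S x y z) (ih : TwoPathsBelow S)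
    (hxy : ¬ G.Adj x y) {a b v : V} (ha : a ∈ S) (hb : b ∈ S) (hv : v ∈ S) (hvx : v ≠ x)
    (hvy : v ≠ y) (hxa : G.Adj x a) (hxb : G.Adj x b) (hva : G.Adj v a) (hvb : G.Adj v b)
    (hab : a ≠ b) : G.TwoPathsIn S x y := by
  have key : ∀ {a b : V} {n : ℕ}, a ∈ S → b ∈ S → G.Adj x a → G.Adj x b → G.Adj v a → G.Adj v b →
      G.PathTo y (((S \ {x}) \ {v}) \ {b}) a n → G.TwoPathsIn S x y := by
    intro a b n ha hb hxa hxb hva hvb p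
    refine ⟨n + 3, n + 1, .cons h.left_mem hxb (.cons ⟨hb, hxb.ne'⟩ hvb.symm
      (.cons ⟨⟨hv, hvx⟩, hvb.ne⟩ hva (p.mono ?_))),
      .cons h.left_mem hxa (p.mono ?_), by omega, by omega⟩
    · exact fun c hc => ⟨⟨hc.1.1, hc.2⟩, hc.1.2⟩
    · exact fun c hc => hc.1.1
  by_cases hay : ∃ n, G.PathTo y ((S \ {x}) \ {v}) a n
  · obtain ⟨n, p⟩ := hay
    rcases p.avoid_or_through hab with q | ⟨m, q⟩
    · exact key ha hb hxa hxb hva hvb q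
    · exact key hb ha hxb hxa hvb hva q
  by_cases hby : ∃ n, G.PathTo y ((S \ {x}) \ {v}) b n
  · obtain ⟨n, p⟩ := hby
    rcases p.avoid_or_through hab.symm with q | ⟨m, q⟩
    · exact key hb ha hxb hxa hvb hva q
    · exact key ha hb hxa hxb hva hvb q
  -- Now `{x, v}` separates `a` and `b` from `y`. Induction on the side `C` gives two `x`–`v` paths,
  -- and both are continued by one `v`–`y` path on the other side.
  set C : Set V := {u | u ∈ (S \ {x}) \ {v} ∧ ¬ ∃ n, G.PathTo y ((S \ {x}) \ {v}) u n} with hC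
  have hyC : y ∉ C := fun hy => hy.2 ⟨0, .nil hy.1⟩
  have haC : a ∈ C := ⟨⟨⟨ha, hxa.ne'⟩, hva.ne'⟩, hay⟩
  have hbC : b ∈ C := ⟨⟨⟨hb, hxb.ne'⟩, hvb.ne'⟩, hby⟩
  have hR : G.IsRooted (C ∪ {x, v}) x v z := by
    refine h.of_separation (fun c hc => hc.1.1.1) (fun hx => hx.1.1.2 rfl) hyC hvx.symm ?_
    intro c hc d hd hcd
    by_contra! hcon
    refine hcon.1 ⟨⟨⟨hd, hcon.2.1⟩, hcon.2.2⟩, ?_⟩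
    rintro ⟨n, p⟩
    exact hc.2 (p.exists_cons hc.1 hcd)
  have hsub : C ∪ {x, v} ⊆ S := by
    rintro c (hc | rfl | rfl)
    exacts [hc.1.1.1, h.left_mem, hv]
  have hss : C ∪ {x, v} ⊂ S := by
    refine ⟨hsub, fun hS => ?_⟩
    rcases hS h.right_mem with hc | hc | hc
    exacts [hyC hc, h.ne hc.symm, hvy hc.symm]
  obtain ⟨m, n, p, q, hmn⟩ := ih _ hss G x v z hR
    ⟨a, ⟨Or.inl haC, by simp [hxa.ne', hva.ne']⟩, b, ⟨Or.inl hbC, by simp [hxb.ne', hvb.ne']⟩, hab⟩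
  obtain ⟨k, r⟩ := h.exists_pathTo_right hv hvx
  cases r with
  | nil => exact absurd rfl hvy
  | @cons _ _ w k hv' hvw r =>
    have r' : G.PathTo y (insert v {c | ∃ m, G.PathTo y ((S \ {x}) \ {v}) c m}) v (k + 1) := by
      refine .cons (by simp) hvw (r.in_component.mono ?_)
      rintro c ⟨m, hc⟩
      exact ⟨Or.inr ⟨m, hc⟩, hc.start_mem.2⟩
    have hdis : ∀ c ∈ C ∪ {x, v},
        c ∈ insert v {c | ∃ m, G.PathTo y ((S \ {x}) \ {v}) c m} → c = v := by
      rintro c hc (rfl | ⟨m, hm⟩)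
      · rfl
      · rcases hc with hc | rfl | rfl
        · exact absurd ⟨m, hm⟩ hc.2
        · exact absurd rfl hm.start_mem.1.2
        · rfl
    have hun : (C ∪ {x, v}) ∪ insert v {c | ∃ m, G.PathTo y ((S \ {x}) \ {v}) c m} ⊆ S := by
      rintro c (hc | rfl | ⟨m, hm⟩)
      exacts [hsub hc, hv, hm.start_mem.1.1]
    exact ⟨_, _, (p.append r' hdis).mono hun, (q.append r' hdis).mono hun, by omega, by omega⟩

end IsRooted

/-- The graph obtained from `G` by making `r` adjacent to exactly the neighbours of `N`. -/
def contractTo (G : SimpleGraph V) (N : Set V) (r : V) : SimpleGraph V where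
  Adj u v := u ≠ v ∧ ((u ≠ r ∧ v ≠ r ∧ G.Adj u v) ∨ (u = r ∧ ∃ b ∈ N, G.Adj v b) ∨
    (v = r ∧ ∃ b ∈ N, G.Adj u b))
  symm := ⟨by
    rintro u v ⟨h, h' | h' | h'⟩
    · exact ⟨h.symm, Or.inl ⟨h'.2.1, h'.1, h'.2.2.symm⟩⟩
    · exact ⟨h.symm, Or.inr (Or.inr h')⟩
    · exact ⟨h.symm, Or.inr (Or.inl h')⟩⟩
  loopless := ⟨fun _ h => h.1 rfl⟩

/-! ### Contraction and the induction step -/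

namespace IsRooted

variable {S : Set V} {x y z : V}

/-- The vertex `r` only lends its name to the contracted set `N`, so that the new graph lives on a
proper subset of `S`. By `huniq` contraction never merges two neighbours of a vertex of `D` other
than the root `t`, so the degree condition survives. -/
theorem exists_paths_of_contraction (h : G.IsRooted S x y z) (ih : TwoPathsBelow S) {N D : Set V}
    {r t : V} (hDS : D ⊆ S) (hrS : r ∈ S) (hr : r ∉ D) (hND : ∀ b ∈ N, b ∉ D) (ht : t ∈ D)
    (hD : ∀ v ∈ D, v ≠ t → v ≠ x ∧ v ≠ y)
    (hcl : ∀ v ∈ D, v ≠ t → ∀ b ∈ S, G.Adj v b → b ∈ D ∨ b ∈ N)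
    (huniq : ∀ v ∈ D, v ≠ t → ∀ b ∈ N, ∀ c ∈ N, G.Adj v b → G.Adj v c → b = c)
    (hconn : ∀ A ⊆ D, A.Nonempty → t ∉ A → ∃ a ∈ A, ∃ b ∈ D, b ∉ A ∧ G.Adj a b)
    (hss : insert r D ⊂ S) (hnt : (D \ {t}).Nontrivial) :
    ∃ b ∈ N, ∃ c ∈ N, ∃ m n, G.PathTo t (insert b D) b m ∧ G.PathTo t (insert c D) c n ∧
      n < m ∧ m ≤ n + 2 := by
  have hrD : ∀ v ∈ D, v ≠ r := fun v hv e => hr (e ▸ hv)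
  have hR : (G.contractTo N r).IsRooted (insert r D) r t z := by
    refine ⟨by simp, Or.inr ht, fun e => hr (e ▸ ht), ?_, ?_⟩
    · intro v hv hvr hvt hvz p q
      have hvD : v ∈ D := hv.resolve_left hvr
      have hdeg := h.deg v (hDS hvD) (hD v hvD hvt).1 (hD v hvD hvt).2 hvz
      have inD : ∀ u ∈ D, G.Adj v u → (G.contractTo N r).Adj v u :=
        fun u hu hvu => ⟨hvu.ne, Or.inl ⟨hvr, hrD u hu, hvu⟩⟩
      by_cases hN : ∃ b ∈ N, G.Adj v b
      · obtain ⟨b, hb, hvb⟩ := hN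
        have step : ∀ s, ∃ u ∈ insert r D, (G.contractTo N r).Adj v u ∧ u ≠ r ∧ u ≠ s := by
          intro s
          obtain ⟨u, hu, hvu, hub, hus⟩ := hdeg b s
          have huD : u ∈ D := (hcl v hvD hvt u hu hvu).resolve_right
            fun huN => hub (huniq v hvD hvt u huN b hb hvu hvb)
          exact ⟨u, Or.inr huD, inD u huD hvu, hrD u huD, hus⟩
        by_cases hp : p = r
        · subst hp
          exact step q
        by_cases hq : q = r
        · subst hq
          obtain ⟨u, h1, h2, h3, h4⟩ := step p
          exact ⟨u, h1, h2, h4, h3⟩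
        exact ⟨r, by simp, ⟨hvr, Or.inr (Or.inr ⟨rfl, b, hb, hvb⟩)⟩, Ne.symm hp, Ne.symm hq⟩
      · obtain ⟨u, hu, hvu, hup, huq⟩ := hdeg p q
        have huD : u ∈ D := (hcl v hvD hvt u hu hvu).resolve_right fun huN => hN ⟨u, huN, hvu⟩
        exact ⟨u, Or.inr huD, inD u huD hvu, hup, huq⟩
    · intro A hA hne hrA htA w
      have hAD : A ⊆ D := fun a ha => (hA ha).resolve_left fun e => hrA (e ▸ ha)
      have hAt : ∀ a ∈ A, a ≠ t := fun a ha e => htA (e ▸ ha)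
      have inD : ∀ a ∈ A, ∀ b ∈ D, G.Adj a b → (G.contractTo N r).Adj a b :=
        fun a ha b hb hab => ⟨hab.ne, Or.inl ⟨hrD a (hAD ha), hrD b hb, hab⟩⟩
      by_cases hw : w = r
      · subst hw
        -- The contracted vertex is forbidden, so the neighbour must come from the connectedness of
        -- `D`.
        obtain ⟨a, ha, b, hb, hbA, hab⟩ := hconn A hAD hne htA
        exact ⟨a, ha, b, Or.inr hb, hbA, hrD b hb, inD a ha b hb hab⟩
      · obtain ⟨a, ha, b, hb, hbA, hbw, hab⟩ := h.link A (hAD.trans hDS) hne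
          (fun hx => (hD x (hAD hx) (hAt x hx)).1 rfl)
          (fun hy => (hD y (hAD hy) (hAt y hy)).2 rfl) w
        rcases hcl a (hAD ha) (hAt a ha) b hb hab with hbD | hbN
        · exact ⟨a, ha, b, Or.inr hbD, hbA, hbw, inD a ha b hbD hab⟩
        · exact ⟨a, ha, r, by simp, hrA, Ne.symm hw, hrD a (hAD ha),
            Or.inr (Or.inr ⟨rfl, b, hbN, hab⟩)⟩
  have hnt' : (insert r D \ {r, t}).Nontrivial := by
    refine hnt.mono ?_
    rintro a ⟨haD, hat⟩
    refine ⟨Or.inr haD, ?_⟩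
    rintro (e | e)
    exacts [hrD a haD e, hat e]
  have lift : ∀ n, (G.contractTo N r).PathTo t (insert r D) r n →
      ∃ b ∈ N, G.PathTo t (insert b D) b n := by
    intro n p
    cases p with
    | nil => exact absurd ht hr
    | @cons _ _ w n _ hrw p =>
      obtain ⟨b, hb, hwb⟩ : ∃ b ∈ N, G.Adj w b := by
        rcases hrw.2 with h' | h' | h'
        exacts [absurd rfl h'.1, h'.2, absurd h'.1.symm hrw.1]
      refine ⟨b, hb, .cons (by simp) hwb.symm (p.map ?_ ?_)⟩
      · intro c hc d hd hcd
        rcases hcd.2 with h' | h' | h'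
        exacts [h'.2.2, absurd h'.1 hc.2, absurd h'.1 hd.2]
      · rintro c ⟨hc, hcr⟩
        have hcD : c ∈ D := hc.resolve_left hcr
        exact ⟨Or.inr hcD, fun e => hND b hb (e ▸ hcD)⟩
  obtain ⟨m, n, p, q, hmn⟩ := ih _ hss _ r t z hR hnt'
  obtain ⟨b, hb, p'⟩ := lift m p
  obtain ⟨c, hc, q'⟩ := lift n q
  exact ⟨b, hb, c, hc, m, n, p', q', hmn⟩

/-- Deleting `y` lowers only the degree of `z`, which is harmless once `z` is the new root; the edge
`zy` then lengthens both paths by one. -/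
theorem twoPathsIn_of_pendant (h : G.IsRooted S x y z) (ih : TwoPathsBelow S)
    (hS : (S \ {x, y}).Nontrivial) (hz : z ∈ S) (hzx : z ≠ x) (hyz : G.Adj y z)
    (hN : ∀ b ∈ S, G.Adj y b → b = z) : G.TwoPathsIn S x y := by
  have hR : G.IsRooted (S \ {y}) x z z := by
    refine ⟨⟨h.left_mem, h.ne⟩, ⟨hz, hyz.ne'⟩, hzx.symm, ?_, ?_⟩
    · intro v hv h1 h2 _ p q
      obtain ⟨u, hu, hvu, h'⟩ := h.deg v hv.1 h1 hv.2 h2 p q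
      refine ⟨u, ⟨hu, ?_⟩, hvu, h'⟩
      rintro rfl
      exact h2 (hN v hv.1 hvu.symm)
    · intro A hA hne hxA hzA w
      obtain ⟨a, ha, b, hb, hbA, hbw, hab⟩ := h.link A (fun a ha => (hA ha).1) hne hxA
        (fun hy => (hA hy).2 rfl) w
      refine ⟨a, ha, b, ⟨hb, ?_⟩, hbA, hbw, hab⟩
      rintro rfl
      exact hzA (hN a (hA ha).1 hab.symm ▸ ha)
  have hnt : ((S \ {y}) \ {x, z}).Nontrivial := by
    obtain ⟨v, ⟨hv, hv'⟩, hvz⟩ := hS.exists_ne z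
    simp only [Set.mem_insert_iff, Set.mem_singleton_iff, not_or] at hv'
    obtain ⟨u, hu, hvu, hux, huz⟩ := h.deg v hv hv'.1 hv'.2 hvz x z
    refine ⟨v, ⟨⟨hv, hv'.2⟩, by simp [hv'.1, hvz]⟩, u, ⟨⟨hu, ?_⟩, by simp [hux, huz]⟩, hvu.ne⟩
    rintro rfl
    exact hvz (hN v hv hvu.symm)
  obtain ⟨m, n, p, q, hmn⟩ := ih (S \ {y})
    ⟨Set.sdiff_subset, fun h' => (h' h.right_mem).2 rfl⟩ G x z z hR hnt
  have hdis : ∀ a ∈ S \ {y}, a ∈ ({z, y} : Set V) → a = z := by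
    rintro a ha (rfl | rfl)
    exacts [rfl, absurd rfl ha.2]
  have hun : (S \ {y}) ∪ {z, y} ⊆ S := by
    rintro a (ha | rfl | rfl)
    exacts [ha.1, hz, h.right_mem]
  exact ⟨_, _, (p.append (.single hyz.symm) hdis).mono hun,
    (q.append (.single hyz.symm) hdis).mono hun, by omega, by omega⟩

theorem twoPathsIn_or_neighbors_subset (h : G.IsRooted S x y z) (ih : TwoPathsBelow S)
    (hS : (S \ {x, y}).Nontrivial) (hxy : ¬ G.Adj x y) :
    G.TwoPathsIn S x y ∨ ∀ b ∈ S, G.Adj y b → G.Adj x b := by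
  by_contra! hcon
  obtain ⟨hno, b₀, hb₀, hyb₀, hxb₀⟩ := hcon
  set N : Set V := {b | b ∈ S ∧ G.Adj x b} with hN
  set T : Set V := {b | b ∈ S ∧ b ≠ x ∧ ¬ G.Adj x b} with hT
  set D : Set V := {u | ∃ n, G.PathTo y T u n} with hD
  have hDT : D ⊆ T := fun u ⟨n, p⟩ => p.start_mem
  have hyD : y ∈ D := ⟨0, .nil ⟨h.right_mem, h.ne.symm, hxy⟩⟩
  have hDcl : ∀ v ∈ D, ∀ b ∈ T, G.Adj v b → b ∈ D :=
    fun v ⟨n, p⟩ b hb hvb => p.exists_cons hb hvb.symm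
  have hcl : ∀ v ∈ D, ∀ b ∈ S, G.Adj v b → b ∈ D ∨ b ∈ N := by
    intro v hv b hb hvb
    by_cases hxb : G.Adj x b
    · exact Or.inr ⟨hb, hxb⟩
    · refine Or.inl (hDcl v hv b ⟨hb, ?_, hxb⟩ hvb)
      rintro rfl
      exact (hDT hv).2.2 hvb.symm
  have huniq : ∀ v ∈ D, v ≠ y → ∀ b ∈ N, ∀ c ∈ N, G.Adj v b → G.Adj v c → b = c := by
    intro v hv hvy b hb c hc hvb hvc
    by_contra hbc
    exact hno (h.twoPathsIn_of_fourCycle ih hxy hb.1 hc.1 (hDT hv).1 (hDT hv).2.1 hvy hb.2 hc.2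
      hvb hvc hbc)
  have hb₀D : b₀ ∈ D := (hcl y hyD b₀ hb₀ hyb₀).resolve_right fun h' => hxb₀ h'.2
  by_cases hnt : (D \ {y}).Nontrivial
  · obtain ⟨b, hb, c, hc, m, n, p, q, hmn⟩ := h.exists_paths_of_contraction ih (N := N) (D := D)
      (r := x) (t := y) (fun u hu => (hDT hu).1) h.left_mem (fun hx => (hDT hx).2.1 rfl)
      (fun b hb hbD => (hDT hbD).2.2 hb.2) hyD (fun v hv hvy => ⟨(hDT hv).2.1, hvy⟩)
      (fun v hv _ => hcl v hv) huniq
      (fun A hA ⟨u, hu⟩ hyA => by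
        obtain ⟨k, r⟩ := hA hu
        obtain ⟨a, ha, b, hb, hbA, hab⟩ := r.exists_boundary hu hyA
        exact ⟨a, ha, b, hDcl a (hA ha) b hb hab, hbA, hab⟩)
      (by
        refine ⟨Set.insert_subset h.left_mem fun u hu => (hDT hu).1, fun hsub => ?_⟩
        -- Properness: `x` has a neighbour in `S \ {x, y}`, and that neighbour is not in `D`.
        obtain ⟨a, ha, b, hb, hbA, hby, hab⟩ := h.link (S \ {x, y}) Set.sdiff_subset hS.nonempty
          (by simp) (by simp) y
        have hbx : b = x := by
          by_contra hbx
          exact hbA ⟨hb, by simp [hbx, hby]⟩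
        subst hbx
        rcases hsub ha.1 with rfl | haD
        · exact hab.ne rfl
        · exact (hDT haD).2.2 hab.symm) hnt
    have hsub : ∀ b ∈ N, insert b D ⊆ S \ {x} := by
      rintro b hb a (rfl | ha)
      exacts [⟨hb.1, hb.2.ne'⟩, ⟨(hDT ha).1, (hDT ha).2.1⟩]
    exact hno ⟨m + 1, n + 1, .cons h.left_mem hb.2 (p.mono (hsub b hb)),
      .cons h.left_mem hc.2 (q.mono (hsub c hc)), by omega, by omega⟩
  -- Here `D = {y, b₀}`. The vertex `b₀` has a neighbour `b` in `N`, so a neighbour of `y` in `N`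
  -- would give paths of lengths 3 and 2. Hence `b₀` is the only neighbour of `y`, and having too
  -- few neighbours it must be `z`.
  · have hDv : ∀ u ∈ D, u ≠ y → u = b₀ := fun u hu huy =>
      (Set.not_nontrivial_iff.mp hnt) ⟨hu, huy⟩ ⟨hb₀D, hyb₀.ne'⟩
    obtain ⟨a, rfl, b, hb, hba, hby, hab⟩ := h.link {b₀} (by simpa using hb₀) (by simp)
      (fun e => (hDT hb₀D).2.1 e.symm) (fun e => hyb₀.ne e) y
    have hbN : b ∈ N := (hcl a hb₀D b hb hab).resolve_left fun hbD => hba (hDv b hbD hby)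
    have hNy : ∀ c ∈ S, G.Adj y c → c = a := by
      intro c hc hyc
      rcases hcl y hyD c hc hyc with hcD | hcN
      · exact hDv c hcD hyc.ne'
      · refine absurd ⟨3, 2, .cons h.left_mem hbN.2 (.cons ⟨hb, hbN.2.ne'⟩ hab.symm
          (.cons ⟨⟨hb₀, (hDT hb₀D).2.1⟩, hab.ne⟩ hyb₀.symm
            (.nil ⟨⟨⟨h.right_mem, h.ne.symm⟩, hby.symm⟩, hyb₀.ne⟩))),
          .cons h.left_mem hcN.2 (.cons ⟨hc, hcN.2.ne'⟩ hyc.symm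
            (.nil ⟨⟨h.right_mem, h.ne.symm⟩, hyc.ne⟩)), by omega, by omega⟩ hno
    have haz : a = z := by
      by_contra haz
      obtain ⟨u, hu, hau, huy, hub⟩ := h.deg a hb₀ (hDT hb₀D).2.1 hyb₀.ne' haz y b
      have huN : u ∈ N := (hcl a hb₀D u hu hau).resolve_left
        fun huD => hau.ne' (hDv u huD huy)
      exact hub (huniq a hb₀D hyb₀.ne' u huN b hbN hau hab)
    subst haz
    exact hno (h.twoPathsIn_of_pendant ih hS hb₀ (hDT hb₀D).2.1 hyb₀ hNy)

theorem twoPathsIn_of_not_adj (h : G.IsRooted S x y z) (ih : TwoPathsBelow S)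
    (hS : (S \ {x, y}).Nontrivial) (hxy : ¬ G.Adj x y) : G.TwoPathsIn S x y := by
  by_contra hno
  have hyx := (h.twoPathsIn_or_neighbors_subset ih hS hxy).resolve_left hno
  have hxy' := (h.symm.twoPathsIn_or_neighbors_subset ih (by rwa [Set.pair_comm])
    fun e => hxy e.symm).resolve_left fun e => hno e.symm
  obtain ⟨a, ha, hxa, haz, b, hb, hxb, hba⟩ :
      ∃ a ∈ S, G.Adj x a ∧ a ≠ z ∧ ∃ b ∈ S, G.Adj x b ∧ b ≠ a := by
    -- Otherwise `x` and `y` have no neighbour in `S` but possibly `w`, and `S \ {x, y, w}` has no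
    -- outside neighbour but `w`.
    have key : ∀ w, ∃ a ∈ S, G.Adj x a ∧ a ≠ w := by
      intro w
      by_contra! hcon
      obtain ⟨u, ⟨hu, hu'⟩, huw⟩ := hS.exists_ne w
      simp only [Set.mem_insert_iff, Set.mem_singleton_iff, not_or] at hu'
      obtain ⟨a, ⟨haS, ha'⟩, b, hb, hbA, hbw, hab⟩ := h.link (S \ {x, y, w})
        Set.sdiff_subset ⟨u, hu, by simp [hu', huw]⟩ (by simp) (by simp) w
      simp only [Set.mem_insert_iff, Set.mem_singleton_iff, not_or] at ha'
      by_cases hbx : b = x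
      · subst hbx
        exact ha'.2.2 (hcon a haS hab.symm)
      by_cases hby : b = y
      · subst hby
        exact ha'.2.2 (hcon a haS (hyx a haS hab.symm))
      exact hbA ⟨hb, by simp [hbx, hby, hbw]⟩
    obtain ⟨a, ha, hxa, haz⟩ := key z
    obtain ⟨b, hb, hxb, hba⟩ := key a
    exact ⟨a, ha, hxa, haz, b, hb, hxb, hba⟩
  set N : Set V := {c | c ∈ S ∧ G.Adj x c ∧ c ≠ a} with hN
  set T : Set V := {c | c ∈ S ∧ c ≠ x ∧ c ≠ y ∧ (G.Adj x c → c = a)} with hT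
  set K : Set V := {u | ∃ n, G.PathTo a T u n} with hK
  have hay : a ≠ y := fun e => hxy (e ▸ hxa)
  have hKT : K ⊆ T := fun u ⟨n, p⟩ => p.start_mem
  have haK : a ∈ K := ⟨0, .nil ⟨ha, hxa.ne', hay, fun _ => rfl⟩⟩
  have hKcl : ∀ v ∈ K, ∀ c ∈ T, G.Adj v c → c ∈ K :=
    fun v ⟨n, p⟩ c hc hvc => p.exists_cons hc hvc.symm
  have hcl : ∀ v ∈ K, v ≠ a → ∀ c ∈ S, G.Adj v c → c ∈ K ∨ c ∈ N := by
    intro v hv hva c hc hvc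
    by_cases hcN : G.Adj x c ∧ c ≠ a
    · exact Or.inr ⟨hc, hcN⟩
    · refine Or.inl (hKcl v hv c ⟨hc, ?_, ?_, fun hxc => ?_⟩ hvc)
      · rintro rfl
        exact hva ((hKT hv).2.2.2 hvc.symm)
      · rintro rfl
        exact hva ((hKT hv).2.2.2 (hyx v (hKT hv).1 hvc.symm))
      · by_contra hca
        exact hcN ⟨hxc, hca⟩
  -- As N(x) = N(y), the paths x c v d y and x c y have lengths 4 and 2.
  have short : ∀ c d v, c ∈ S → d ∈ S → v ∈ S → v ≠ x → v ≠ y → c ≠ d → G.Adj x c → G.Adj x d →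
      G.Adj v c → G.Adj v d → False := by
    intro c d v hc hd hv hvx hvy hcd hxc hxd hvc hvd
    have hcy : c ≠ y := fun e => hxy (e ▸ hxc)
    have hdy : d ≠ y := fun e => hxy (e ▸ hxd)
    have hyS := h.right_mem
    refine hno ⟨4, 2, .cons h.left_mem hxc (.cons ⟨hc, hxc.ne'⟩ hvc.symm (.cons ?_ hvd
      (.cons ?_ (hxy' d hd hxd).symm (.nil ?_)))),
      .cons h.left_mem hxc (.cons ⟨hc, hxc.ne'⟩ (hxy' c hc hxc).symm (.nil ?_)), by omega, by omega⟩
    · exact ⟨⟨hv, hvx⟩, hvc.ne⟩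
    · exact ⟨⟨⟨hd, hxd.ne'⟩, hcd.symm⟩, hvd.ne'⟩
    · exact ⟨⟨⟨⟨hyS, h.ne.symm⟩, hcy.symm⟩, hvy.symm⟩, hdy.symm⟩
    · exact ⟨⟨hyS, h.ne.symm⟩, hcy.symm⟩
  obtain ⟨u, hu, hau, hux, huy⟩ := h.deg a ha hxa.ne' hay haz x y
  have huN : ¬ G.Adj x u := fun hxu => hno (h.twoPathsIn_of_triangle ha hu hxa hxu hau)
  have huK : u ∈ K := hKcl a haK u ⟨hu, hux, huy, fun e => absurd e huN⟩ hau
  by_cases hnt : (K \ {a}).Nontrivial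
  · obtain ⟨c, hc, d, hd, m, n, p, q, hmn⟩ := h.exists_paths_of_contraction ih (N := N) (D := K)
      (r := y) (t := a) (fun u hu => (hKT hu).1) h.right_mem (fun hy => (hKT hy).2.2.1 rfl)
      (fun c hc hcK => hc.2.2 ((hKT hcK).2.2.2 hc.2.1)) haK
      (fun v hv _ => ⟨(hKT hv).2.1, (hKT hv).2.2.1⟩) hcl
      (fun v hv hva c hc d hd hvc hvd => by
        by_contra hcd
        exact short c d v hc.1 hd.1 (hKT hv).1 (hKT hv).2.1 (hKT hv).2.2.1 hcd hc.2.1 hd.2.1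
          hvc hvd)
      (fun A hA ⟨u, hu⟩ hyA => by
        obtain ⟨k, r⟩ := hA hu
        obtain ⟨a, ha, b, hb, hbA, hab⟩ := r.exists_boundary hu hyA
        exact ⟨a, ha, b, hKcl a (hA ha) b hb hab, hbA, hab⟩)
      ⟨Set.insert_subset h.right_mem fun u hu => (hKT hu).1, fun hsub =>
        (hsub h.left_mem).elim h.ne fun hx => (hKT hx).2.1 rfl⟩ hnt
    have lift : ∀ c ∈ N, ∀ k, G.PathTo a (insert c K) c k → G.PathTo y S x (k + 1 + 1) := by
      intro c hc k r
      have hcy : c ≠ y := fun e => hxy (e ▸ hc.2.1)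
      refine .cons h.left_mem hxa ((r.reverse.append (.single (hxy' c hc.1 hc.2.1).symm) ?_).mono ?_)
      · rintro d hd (rfl | rfl)
        · rfl
        · rcases hd with rfl | hd
          exacts [rfl, absurd rfl (hKT hd).2.2.1]
      · rintro d ((rfl | hd) | (rfl | rfl))
        exacts [⟨hc.1, hc.2.1.ne'⟩, ⟨(hKT hd).1, (hKT hd).2.1⟩, ⟨hc.1, hc.2.1.ne'⟩,
          ⟨h.right_mem, h.ne.symm⟩]
    exact hno ⟨m + 1 + 1, n + 1 + 1, lift c hc m p, lift d hd n q, by omega, by omega⟩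
  -- Here `K = {a, u}`, so a neighbour of `u` other than `a` lies in `N`, and `short` applies to `a`
  -- and that neighbour.
  · obtain ⟨v, rfl, c, hc, hcv, hca, hvc⟩ := h.link {u} (by simpa using hu) (by simp)
      (fun e => hux e.symm) (fun e => huy e.symm) a
    rcases hcl v huK hau.ne' c hc hvc with hcK | hcN
    · exact hcv (Set.not_nontrivial_iff.mp hnt ⟨hcK, hca⟩ ⟨huK, hau.ne'⟩)
    · exact short a c v ha hc hu hux huy hca.symm hxa hcN.2.1 hau.symm hvc

theorem twoPathsIn [Finite V] (h : G.IsRooted S x y z) (hS : (S \ {x, y}).Nontrivial) :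
    G.TwoPathsIn S x y := by
  induction S using WellFoundedLT.induction generalizing G x y z with
  | ind S ih =>
  have hne : ∀ a b, a ≠ x → a ≠ y → s(a, b) ≠ s(x, y) := by
    intro a b hax hay e
    rcases Sym2.eq_iff.mp e with ⟨e, -⟩ | ⟨e, -⟩
    exacts [hax e, hay e]
  have hR : (G.deleteEdges {s(x, y)}).IsRooted S x y z := by
    refine ⟨h.left_mem, h.right_mem, h.ne, ?_, ?_⟩
    · intro v hv h1 h2 h3 p q
      obtain ⟨u, hu, hvu, h'⟩ := h.deg v hv h1 h2 h3 p q
      exact ⟨u, hu, by simpa [deleteEdges_adj] using ⟨hvu, by simpa using hne v u h1 h2⟩, h'⟩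
    · intro A hA hn hx hy w
      obtain ⟨a, ha, b, hb, hbA, hbw, hab⟩ := h.link A hA hn hx hy w
      exact ⟨a, ha, b, hb, hbA, hbw, deleteEdges_adj.mpr
        ⟨hab, hne a b (fun e => hx (e ▸ ha)) (fun e => hy (e ▸ ha))⟩⟩
  obtain ⟨m, n, p, q, hmn⟩ := hR.twoPathsIn_of_not_adj
    (fun S' hS' G x y z h hn => ih S' hS' h hn) hS (by simp)
  have hle : ∀ a ∈ S, ∀ b ∈ S, (G.deleteEdges {s(x, y)}).Adj a b → G.Adj a b :=
    fun a _ b _ hab => (deleteEdges_adj.mp hab).1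
  exact ⟨m, n, p.map hle subset_rfl, q.map hle subset_rfl, hmn⟩

end IsRooted

/-! ### From 2-connected graphs to rooted ones -/

theorem IsTwoConnected.exists_adj_ne (h : G.IsTwoConnected) {A : Set V} (hA : A.Nonempty) {x y : V}
    (hxy : x ≠ y) (hx : x ∉ A) (hy : y ∉ A) (w : V) : ∃ a ∈ A, ∃ b, b ∉ A ∧ b ≠ w ∧ G.Adj a b := by
  obtain ⟨-, hconn, hdel⟩ := h
  by_cases hw : ∃ a ∈ A, a ≠ w
  · obtain ⟨a, ha, haw⟩ := hw
    obtain ⟨r, hrA, hrw⟩ : ∃ r, r ∉ A ∧ r ≠ w := by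
      by_cases e : x = w
      · exact ⟨y, hy, fun e' => hxy (e.trans e'.symm)⟩
      · exact ⟨x, hx, e⟩
    obtain ⟨p⟩ := (hdel w).preconnected ⟨a, haw⟩ ⟨r, hrw⟩
    obtain ⟨d, -, h1, h2⟩ := p.exists_boundary_dart {u | u.1 ∈ A} ha hrA
    exact ⟨_, h1, _, h2, d.snd.2, d.adj⟩
  -- Now `A = {w}`, so any neighbour outside `A` differs from `w` and connectedness suffices.
  · push Not at hw
    obtain ⟨a, ha⟩ := hA
    obtain ⟨p⟩ := hconn.preconnected a x
    obtain ⟨d, -, h1, h2⟩ := p.exists_boundary_dart A ha hx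
    refine ⟨_, h1, _, h2, ?_, d.adj⟩
    rintro e
    exact h2 (e ▸ hw a ha ▸ ha)

theorem IsTwoConnected.adj_of_forall_eq (h : G.IsTwoConnected) {x y w : V} (hxy : x ≠ y)
    (hV : ∀ v, v = x ∨ v = y ∨ v = w) (hxw : x ≠ w) (hyw : y ≠ w) : G.Adj x y := by
  obtain ⟨p⟩ := (h.2.2 w).preconnected ⟨x, hxw⟩ ⟨y, hyw⟩
  obtain ⟨d, -, h1, h2⟩ := p.exists_boundary_dart {⟨x, hxw⟩} rfl
    (fun e => hxy (congrArg Subtype.val e).symm)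
  have h1' : d.fst.1 = x := congrArg Subtype.val h1
  have h2' : d.snd.1 = y := by
    rcases hV d.snd.1 with e | e | e
    · exact absurd (Subtype.ext e) h2
    · exact e
    · exact absurd e d.snd.2
  have := d.adj
  rw [comap_adj] at this
  simpa [h1', h2'] using this

theorem IsTwoConnected.isRooted [Fintype V] [DecidableEq V] [DecidableRel G.Adj]
    (h : G.IsTwoConnected) {x y z : V} (hxy : x ≠ y)
    (hdeg : ∀ v, v ≠ x → v ≠ y → v ≠ z → G.degree v = 3) :
    (G.deleteEdges {s(x, y)}).IsRooted Set.univ x y z := by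
  have hne : ∀ a b, a ≠ x → a ≠ y → s(a, b) ≠ s(x, y) := by
    intro a b hax hay e
    rcases Sym2.eq_iff.mp e with ⟨e, -⟩ | ⟨e, -⟩
    exacts [hax e, hay e]
  refine ⟨trivial, trivial, hxy, ?_, ?_⟩
  · intro v _ h1 h2 h3 p q
    have hlt : ({p, q} : Finset V).card < (G.neighborFinset v).card := by
      rw [card_neighborFinset_eq_degree, hdeg v h1 h2 h3]
      exact lt_of_le_of_lt Finset.card_le_two (by omega)
    obtain ⟨u, hu, hu'⟩ := Finset.exists_mem_notMem_of_card_lt_card hlt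
    rw [mem_neighborFinset] at hu
    simp only [Finset.mem_insert, Finset.mem_singleton, not_or] at hu'
    exact ⟨u, trivial, deleteEdges_adj.mpr ⟨hu, hne v u h1 h2⟩, hu'⟩
  · intro A _ hA hx hy w
    obtain ⟨a, ha, b, hb, hbw, hab⟩ := h.exists_adj_ne hA hxy hx hy w
    exact ⟨a, ha, b, trivial, hb, hbw, deleteEdges_adj.mpr
      ⟨hab, hne a b (fun e => hx (e ▸ ha)) (fun e => hy (e ▸ ha))⟩⟩

theorem IsTwoConnected.exists_third_of_subsingleton (h : G.IsTwoConnected) {x y : V}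
    (hV : ¬ (Set.univ \ {x, y} : Set V).Nontrivial) :
    ∃ w, x ≠ w ∧ y ≠ w ∧ ∀ v, v = x ∨ v = y ∨ v = w := by
  obtain ⟨w, hw⟩ : ∃ w, w ∉ ({x, y} : Set V) := by
    by_contra! hcon
    have h1 : (Set.univ : Set V).encard ≤ ({x, y} : Set V).encard :=
      Set.encard_le_encard fun v _ => hcon v
    rw [Set.encard_univ] at h1
    have h2 := (h.1.trans h1).trans (Set.encard_insert_le {y} x)
    rw [Set.encard_singleton] at h2
    exact absurd h2 (by norm_num)
  refine ⟨w, fun e => hw (by simp [e]), fun e => hw (by simp [e]), fun v => ?_⟩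
  by_contra! hv
  exact hv.2.2 (Set.not_nontrivial_iff.mp hV ⟨trivial, by simp [hv]⟩ ⟨trivial, hw⟩)

end SimpleGraph

theorem mainTheorem7 {V : Type*} [Fintype V] [DecidableEq V] (G : SimpleGraph V)
    [DecidableRel G.Adj] (hG : G.IsTwoConnected) :
    (∀ x y z : V, x ≠ y → G.IsSubcubic →
      (∀ v : V, v ≠ x → v ≠ y → v ≠ z → G.degree v = 3) →
      G.HasTwoPathsDifferingByOneOrTwo x y) ∧
    (∀ x y z : V, ¬ Nonempty (G ≃g SimpleGraph.cycleGraph 3) → G.Adj x y → z ≠ x → z ≠ y →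
      G.degree x ≤ 4 → G.degree y ≤ 4 → G.degree z ≤ 3 →
      (∀ v : V, v ≠ x → v ≠ y → v ≠ z → G.degree v = 3) →
      (G.deleteEdges {s(x, y)}).HasTwoPathsDifferingByOneOrTwo x y) := by
  refine ⟨fun x y z hxy _ hdeg => ?_, fun x y z hC hxy hzx hzy _ _ _ hdeg => ?_⟩
  · by_cases hV : (Set.univ \ {x, y} : Set V).Nontrivial
    · obtain ⟨m, n, p, q, hmn⟩ := (hG.isRooted hxy hdeg).twoPathsIn hV
      have hle : ∀ a ∈ (Set.univ : Set V), ∀ b ∈ (Set.univ : Set V),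
          (G.deleteEdges {s(x, y)}).Adj a b → G.Adj a b :=
        fun a _ b _ hab => (SimpleGraph.deleteEdges_adj.mp hab).1
      exact SimpleGraph.TwoPathsIn.hasTwoPaths ⟨m, n, p.map hle subset_rfl, q.map hle subset_rfl, hmn⟩
    -- With three vertices the graph is a triangle, with paths of lengths 2 and 1.
    · obtain ⟨w, hxw, hyw, hw⟩ := hG.exists_third_of_subsingleton hV
      have h1 := hG.adj_of_forall_eq hxy hw hxw hyw
      have h2 := hG.adj_of_forall_eq hxw (w := y) (fun v => by have := hw v; tauto) hxy hyw.symm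
      have h3 := hG.adj_of_forall_eq hyw.symm (w := x) (fun v => by have := hw v; tauto)
        hxw.symm hxy.symm
      exact SimpleGraph.TwoPathsIn.hasTwoPaths (T := Set.univ) ⟨2, 1,
        .cons trivial h2 (.cons ⟨trivial, hxw.symm⟩ h3 (.nil ⟨⟨trivial, hxy.symm⟩, hyw⟩)),
        .cons trivial h1 (.nil ⟨trivial, hxy.symm⟩), by omega, by omega⟩
  · refine ((hG.isRooted hxy.ne hdeg).twoPathsIn ?_).hasTwoPaths
    by_contra hV
    obtain ⟨w, hxw, hyw, hw⟩ := hG.exists_third_of_subsingleton hV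
    refine hC ?_
    have h2 := hG.adj_of_forall_eq hxw (w := y) (fun v => by have := hw v; tauto) hxy.ne hyw.symm
    have h3 := hG.adj_of_forall_eq hyw.symm (w := x) (fun v => by have := hw v; tauto)
      hxw.symm hxy.ne.symm
    have htop : G = ⊤ := by
      ext u v
      rw [SimpleGraph.top_adj]
      refine ⟨fun h => h.ne, fun huv => ?_⟩
      rcases hw u with rfl | rfl | rfl <;> rcases hw v with rfl | rfl | rfl <;>
        first | exact absurd rfl huv | assumption | (apply SimpleGraph.Adj.symm; assumption)
    have hcard : Fintype.card V = 3 := by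
      rw [← Finset.card_univ, Finset.card_eq_three]
      refine ⟨x, y, w, hxy.ne, hxw, hyw, ?_⟩
      ext v
      simpa using hw v
    rw [htop, SimpleGraph.cycleGraph_three_eq_top]
    exact ⟨SimpleGraph.Iso.completeGraph (Fintype.equivFinOfCardEq hcard)⟩
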